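/- Let $|xy\rangle$ denote the product basis vectors of $\mathbb{C}^d\otimes\mathbb{C}^{d'}$, $d'\ge d$ (states are given by nonzero vectors, up to normalization), where the first factor is held by Alice and the second by Bob. Consider any one of the following sets of pairwise orthogonal states: 1. for $d'\ge d\ge 2$: $|\nu_{k+1}\rangle=\sum_{j=0}^{d-1}e^{2\pi i kj/d}\,|jj\rangle$ for $k=0,\dots,d-1$, together with $|\nu_{d+1}\rangle=|01\rangle$; 2. for $d=3$, $d'\ge 3$: the set in 1 together with $|02\rangle$; 3. for $d=4$, $d'\ge 4$: $|00\rangle+|11\rangle+|22\rangle+|33\rangle$, $|00\rangle+|11\rangle-|22\rangle-|33\rangle$, $|00\rangle-|11\rangle-|22\rangle+|33\rangle$, $|00\rangle-|11\rangle+|22\rangle-|33\rangle$, $|01\rangle$; 4. for $d=4$, $d'\ge 4$ and real numbers $a,b,\mathsf{c},\mathsf{d},e,f,g,h\in(0,1)$ with $a^2+b^2=\mathsf{c}^2+\mathsf{d}^2=e^2+f^2=g^2+h^2=1$: $e|\phi_1\rangle+f|\phi_3\rangle$, $f|\phi_1\rangle-e|\phi_3\rangle$, $g|\phi_2\rangle+h|\phi_4\rangle$,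 $h|\phi_2\rangle-g|\phi_4\rangle$, $|01\rangle$, where $|\phi_1\rangle=a|00\rangle+b|11\rangle$, $|\phi_2\rangle=b|00\rangle-a|11\rangle$, $|\phi_3\rangle=\mathsf{c}|22\rangle+\mathsf{d}|33\rangle$, $|\phi_4\rangle=\mathsf{d}|22\rangle-\mathsf{c}|33\rangle$. Say that states $|\psi_1\rangle,\dots,|\psi_n\rangle$ are conclusively distinguishable under LOCC if there is a finite-round protocol of local operations and classical communication with answers in $\{1,\dots,n,\text{inconclusive}\}$ which, on $|\psi_i\rangle$, answers $i$ with nonzero probability and answers $j$ with probability zero for every $j\ne i$, for all $i$. Then every pure entangled state is useful as a resource for distinguishing the states of the set conclusively: the states $|\psi_i\rangle$ of the set are not conclusively distinguishable under LOCC, but for all $m,m'$ and every entangled (i.e. not product) pure state $|\Phi\rangle\in\mathbb{C}^m\otimes\mathbb{C}^{m'}$ shared by Alice and Bob, the states $|\psi_i\rangle\otimes|\Phi\rangle$ are conclusively distinguishable under LOCC. -/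

import Mathlib

noncomputable section

/-- A (not necessarily normalized) vector of `ℂ^α ⊗ ℂ^β`, given by its coefficients in the
product basis. The first factor belongs to Alice, the second one to Bob. -/
abbrev BiVec (α β : Type) : Type := α × β → ℂ

namespace BiVec

variable {α β α' β' : Type}

/-- The squared Hilbert space norm. -/
def normSq [Fintype α] [Fintype β] (ψ : BiVec α β) : ℝ := ∑ p, ‖ψ p‖ ^ 2

/-- `(K ⊗ 1) ψ`: the operator `K` acts on Alice's side. -/
def actA [Fintype α] (K : Matrix α' α ℂ) (ψ : BiVec α β) : BiVec α' β :=
  fun p => ∑ x, K p.1 x * ψ (x, p.2)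

/-- `(1 ⊗ L) ψ`: the operator `L` acts on Bob's side. -/
def actB [Fintype β] (L : Matrix β' β ℂ) (ψ : BiVec α β) : BiVec α β' :=
  fun p => ∑ y, L p.2 y * ψ (p.1, y)

/-- The joint vector `ψ ⊗ Φ`, where Alice holds the first parts of both `ψ` and `Φ`, and Bob
holds the second parts of both. -/
def withResource (ψ : BiVec α β) (Φ : BiVec α' β') : BiVec (α × α') (β × β') :=
  fun p => ψ (p.1.1, p.2.1) * Φ (p.1.2, p.2.2)

/-- A product vector `a ⊗ b` (the zero vector is one of them). -/
def IsProduct (Φ : BiVec α β) : Prop :=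
  ∃ (a : α → ℂ) (b : β → ℂ), ∀ x y, Φ (x, y) = a x * b y

/-- A pure state is entangled if it is not a product state. In particular the vector is
nonzero; it need not be normalized. -/
def IsEntangled (Φ : BiVec α β) : Prop := ¬ Φ.IsProduct

end BiVec

/-- A finite-round LOCC protocol with final answers in `R` on the system `ℂ^α ⊗ ℂ^β`.
It either stops with an answer, or one of the parties performs a generalized measurement with
finitely many outcomes (Kraus operators `K i` with `∑ i, (K i)ᴴ * K i = 1`, whose output spaces
`ℂ^(n i)` are arbitrary, so that local ancillas may be added and local subsystems discarded),
announces the outcome `i`, and the parties go on with a protocol that may depend on `i`. -/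
inductive LOCC (R : Type) : Type → Type → Type 1
  | done {α β : Type} (r : R) : LOCC R α β
  | alice {α β : Type} [DecidableEq α] (k : ℕ) (n : Fin k → ℕ)
      (K : ∀ i, Matrix (Fin (n i)) α ℂ) (hK : ∑ i, (K i).conjTranspose * K i = 1)
      (next : ∀ i, LOCC R (Fin (n i)) β) : LOCC R α β
  | bob {α β : Type} [DecidableEq β] (k : ℕ) (n : Fin k → ℕ)
      (L : ∀ i, Matrix (Fin (n i)) β ℂ) (hL : ∑ i, (L i).conjTranspose * L i = 1)
      (next : ∀ i, LOCC R α (Fin (n i))) : LOCC R α β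

namespace LOCC

variable {R : Type} [DecidableEq R]

/-- The total squared norm of the unnormalized final vectors at the leaves of the protocol with
answer `r`, when the protocol is run on `ψ`. -/
def weight (r : R) : {α β : Type} → [Fintype α] → [Fintype β] → LOCC R α β → BiVec α β → ℝ
  | _, _, _, _, .done r', ψ => if r' = r then ψ.normSq else 0
  | _, _, _, _, @LOCC.alice _ _ _ _ _ _ K _ next, ψ => ∑ i, weight r (next i) (ψ.actA (K i))
  | _, _, _, _, @LOCC.bob _ _ _ _ _ _ L _ next, ψ => ∑ i, weight r (next i) (ψ.actB (L i))

/-- The probability that the protocol, run on the state proportional to `ψ`, answers `r`. -/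
def prob {α β : Type} [Fintype α] [Fintype β] (P : LOCC R α β) (ψ : BiVec α β) (r : R) : ℝ :=
  P.weight r ψ / ψ.normSq

end LOCC

/-- The states `ψ i` can be distinguished conclusively (unambiguously) under LOCC: some LOCC
protocol answers with an index, or with the inconclusive answer `none`, it never answers with a
wrong index, and every state is identified with nonzero probability. -/
def ConclusivelyDistinguishable {ι α β : Type} [DecidableEq ι] [Fintype α] [Fintype β]
    (ψ : ι → BiVec α β) : Prop :=
  ∃ P : LOCC (Option ι) α β,
    (∀ i, 0 < P.prob (ψ i) (some i)) ∧ ∀ i j, i ≠ j → P.prob (ψ i) (some j) = 0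

/-- The product basis vector `|x y⟩` of `ℂ^d ⊗ ℂ^d'`, where `x < d` and `y < d'`. -/
def ket {d d' : ℕ} (x y : ℕ) : BiVec (Fin d) (Fin d') :=
  fun p => if (p.1 : ℕ) = x ∧ (p.2 : ℕ) = y then 1 else 0

/-- The `d + 1` vectors `∑_{j<d} (e^{2πi/d})^{k j} |j j⟩`, `k = 0, …, d - 1`, and `|0 1⟩`. -/
def nuSet (d d' : ℕ) : Fin (d + 1) → BiVec (Fin d) (Fin d') :=
  Fin.snoc (α := fun _ => BiVec (Fin d) (Fin d'))
    (fun k : Fin d => ∑ j : Fin d,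
      Complex.exp (2 * Real.pi * Complex.I / d) ^ ((k : ℕ) * (j : ℕ)) • ket j j)
    (ket 0 1)

/-- The set `nuSet` in dimension 3, enlarged by the product vector `|0 2⟩`. -/
def nuSetExtended (d' : ℕ) : Fin 5 → BiVec (Fin 3) (Fin d') :=
  Fin.snoc (α := fun _ => BiVec (Fin 3) (Fin d')) (nuSet 3 d') (ket 0 2)

/-- Four maximally entangled vectors with real coefficients, and `|0 1⟩`. -/
def muSet (d' : ℕ) : Fin 5 → BiVec (Fin 4) (Fin d') :=
  ![ket 0 0 + ket 1 1 + ket 2 2 + ket 3 3,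
    ket 0 0 + ket 1 1 - ket 2 2 - ket 3 3,
    ket 0 0 - ket 1 1 - ket 2 2 + ket 3 3,
    ket 0 0 - ket 1 1 + ket 2 2 - ket 3 3,
    ket 0 1]

/-- Four entangled vectors, in general not maximally entangled, and `|0 1⟩`. -/
def alphaSet (d' : ℕ) (a b c d e f g h : ℝ) : Fin 5 → BiVec (Fin 4) (Fin d') :=
  let φ₁ : BiVec (Fin 4) (Fin d') := (a : ℂ) • ket 0 0 + (b : ℂ) • ket 1 1
  let φ₂ : BiVec (Fin 4) (Fin d') := (b : ℂ) • ket 0 0 - (a : ℂ) • ket 1 1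
  let φ₃ : BiVec (Fin 4) (Fin d') := (c : ℂ) • ket 2 2 + (d : ℂ) • ket 3 3
  let φ₄ : BiVec (Fin 4) (Fin d') := (d : ℂ) • ket 2 2 - (c : ℂ) • ket 3 3
  ![(e : ℂ) • φ₁ + (f : ℂ) • φ₃,
    (f : ℂ) • φ₁ - (e : ℂ) • φ₃,
    (g : ℂ) • φ₂ + (h : ℂ) • φ₄,
    (h : ℂ) • φ₂ - (g : ℂ) • φ₄,
    ket 0 1]

/-- The constructed sets of states of `ℂ^d ⊗ ℂ^d'`, where `d' ≥ d ≥ 2`. -/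
inductive IsConstructedSet :
    {d d' n : ℕ} → (Fin n → BiVec (Fin d) (Fin d')) → Prop
  | nu (d d' : ℕ) (hd : 2 ≤ d) (hd' : d ≤ d') : IsConstructedSet (nuSet d d')
  | nuExtended (d' : ℕ) (hd' : 3 ≤ d') : IsConstructedSet (nuSetExtended d')
  | mu (d' : ℕ) (hd' : 4 ≤ d') : IsConstructedSet (muSet d')
  | alpha (d' : ℕ) (hd' : 4 ≤ d') (a b c d e f g h : ℝ)
      (ha : 0 < a ∧ a < 1) (hb : 0 < b ∧ b < 1) (hc : 0 < c ∧ c < 1) (hd : 0 < d ∧ d < 1)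
      (he : 0 < e ∧ e < 1) (hf : 0 < f ∧ f < 1) (hg : 0 < g ∧ g < 1) (hh : 0 < h ∧ h < 1)
      (hab : a ^ 2 + b ^ 2 = 1) (hcd : c ^ 2 + d ^ 2 = 1)
      (hef : e ^ 2 + f ^ 2 = 1) (hgh : g ^ 2 + h ^ 2 = 1) :
      IsConstructedSet (alphaSet d' a b c d e f g h)

end

/-! A state `ψ i` can be identified conclusively by LOCC exactly when some product functional `u ⊗
v` is nonzero on `ψ i` and zero on all other states. Necessity: every branch of a protocol acts by a
product operator, so a coordinate of a final vector is a product functional of the input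
(`LOCC.exists_prodForm`). Sufficiency: draw `i` at random and test locally for its functional
(`conclusivelyDistinguishable_of_prodForm`).

An entangled resource has Schmidt rank at least two, which makes functionals `p₁ ⊗ q₁ + p₂ ⊗ q₂` of
rank two available as well.

All the sets share one shape, `IsDiagonalFamily`. A product functional isolating a diagonal state
with full support has `u j * v j ≠ 0` for every `j`, hence `u 0 * v 1 ≠ 0`, and it fails to
annihilate `|0 1⟩`. A functional of rank two can decouple the index `0` from the rest and so avoids
this obstruction. -/

noncomputable section

/-! ### Product functionals and local operators -/

namespace BiVec

variable {α β α' β' : Type} [Fintype α] [Fintype β] [Fintype α'] [Fintype β']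

/-- The bilinear functional `⟨ū ⊗ v̄, ψ⟩` given by a product vector. -/
def prodForm (u : α → ℂ) (v : β → ℂ) (ψ : BiVec α β) : ℂ :=
  ∑ x, ∑ y, u x * v y * ψ (x, y)

lemma normSq_nonneg (ψ : BiVec α β) : 0 ≤ ψ.normSq :=
  Finset.sum_nonneg fun _ _ => by positivity

lemma normSq_eq_zero {ψ : BiVec α β} : ψ.normSq = 0 ↔ ψ = 0 := by
  rw [normSq, Finset.sum_eq_zero_iff_of_nonneg fun _ _ => by positivity]
  simp [funext_iff]

lemma prodForm_actA (u : α' → ℂ) (v : β → ℂ) (K : Matrix α' α ℂ) (ψ : BiVec α β) :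
    prodForm u v (ψ.actA K) = prodForm (Matrix.vecMul u K) v ψ := by
  simp only [prodForm, actA, Matrix.vecMul, dotProduct, Finset.mul_sum, Finset.sum_mul]
  calc _ = ∑ x : α', ∑ z : α, ∑ y : β, u x * v y * (K x z * ψ (z, y)) :=
        Finset.sum_congr rfl fun _ _ => Finset.sum_comm
    _ = ∑ z : α, ∑ x : α', ∑ y : β, u x * v y * (K x z * ψ (z, y)) := Finset.sum_comm
    _ = ∑ z : α, ∑ y : β, ∑ x : α', u x * v y * (K x z * ψ (z, y)) :=
        Finset.sum_congr rfl fun _ _ => Finset.sum_comm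
    _ = _ := by
        refine Finset.sum_congr rfl fun _ _ => Finset.sum_congr rfl fun _ _ =>
          Finset.sum_congr rfl fun _ _ => ?_
        ring

lemma prodForm_actB (u : α → ℂ) (v : β' → ℂ) (L : Matrix β' β ℂ) (ψ : BiVec α β) :
    prodForm u v (ψ.actB L) = prodForm u (Matrix.vecMul v L) ψ := by
  simp only [prodForm, actB, Matrix.vecMul, dotProduct, Finset.mul_sum, Finset.sum_mul]
  refine Finset.sum_congr rfl fun _ _ => ?_
  rw [Finset.sum_comm]
  refine Finset.sum_congr rfl fun _ _ => Finset.sum_congr rfl fun _ _ => ?_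
  ring

lemma prodForm_single [DecidableEq α] [DecidableEq β] (x : α) (y : β) (ψ : BiVec α β) :
    prodForm (Pi.single x 1) (Pi.single y 1) ψ = ψ (x, y) := by
  simp [prodForm, Pi.single_apply, ite_mul]

lemma prodForm_zero (u : α → ℂ) (v : β → ℂ) : prodForm u v 0 = 0 := by
  simp [prodForm]

end BiVec

/-! ### Necessity of an isolating product functional -/

namespace LOCC

open BiVec

variable {R : Type} [DecidableEq R]

lemma weight_nonneg (r : R) {α β : Type} (P : LOCC R α β) : ∀ [Fintype α] [Fintype β]
    (ψ : BiVec α β), 0 ≤ P.weight r ψ := by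
  induction P with
  | done r' =>
    intro _ _ ψ
    rw [weight]
    split_ifs
    exacts [normSq_nonneg _, le_rfl]
  | alice k n K hK next ih =>
    intro _ _ ψ
    rw [weight]
    exact Finset.sum_nonneg fun i _ => ih i _
  | bob k n L hL next ih =>
    intro _ _ ψ
    rw [weight]
    exact Finset.sum_nonneg fun i _ => ih i _

/-- A product functional read off from a branch of a protocol. -/
theorem exists_prodForm (r : R) {α β : Type} (P : LOCC R α β) : ∀ [Fintype α] [Fintype β]
    (ψ : BiVec α β), P.weight r ψ ≠ 0 →
    ∃ (u : α → ℂ) (v : β → ℂ), prodForm u v ψ ≠ 0 ∧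
      ∀ χ : BiVec α β, P.weight r χ = 0 → prodForm u v χ = 0 := by
  induction P with
  | done r' =>
    classical
    intro _ _ ψ h
    rw [weight] at h
    split_ifs at h with hr
    · obtain ⟨p, hp⟩ : ∃ p, ψ p ≠ 0 := by
        by_contra! hc
        exact h (normSq_eq_zero.2 (funext hc))
      refine ⟨Pi.single p.1 1, Pi.single p.2 1, by rwa [prodForm_single], fun χ hχ => ?_⟩
      rw [weight, if_pos hr, normSq_eq_zero] at hχ
      rw [hχ, prodForm_zero]
    · exact absurd rfl h
  | alice k n K hK next ih =>
    intro _ _ ψ h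
    rw [weight] at h
    obtain ⟨i, -, hi⟩ := Finset.exists_ne_zero_of_sum_ne_zero h
    obtain ⟨u, v, huv, hz⟩ := ih i _ hi
    refine ⟨Matrix.vecMul u (K i), v, by rwa [← prodForm_actA], fun χ hχ => ?_⟩
    -- Branch weights are nonnegative, so zero total weight on `χ` forces zero weight in the chosen
    -- branch.
    rw [weight, Finset.sum_eq_zero_iff_of_nonneg fun i _ => weight_nonneg _ _ _] at hχ
    rw [← prodForm_actA]
    exact hz _ (hχ i (Finset.mem_univ _))
  | bob k n L hL next ih =>
    intro _ _ ψ h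
    rw [weight] at h
    obtain ⟨i, -, hi⟩ := Finset.exists_ne_zero_of_sum_ne_zero h
    obtain ⟨u, v, huv, hz⟩ := ih i _ hi
    refine ⟨u, Matrix.vecMul v (L i), by rwa [← prodForm_actB], fun χ hχ => ?_⟩
    rw [weight, Finset.sum_eq_zero_iff_of_nonneg fun i _ => weight_nonneg _ _ _] at hχ
    rw [← prodForm_actB]
    exact hz _ (hχ i (Finset.mem_univ _))

end LOCC

open BiVec

theorem ConclusivelyDistinguishable.exists_prodForm {ι α β : Type} [DecidableEq ι] [Fintype α]
    [Fintype β] {ψ : ι → BiVec α β} (h : ConclusivelyDistinguishable ψ) (i : ι) :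
    ∃ (u : α → ℂ) (v : β → ℂ), prodForm u v (ψ i) ≠ 0 ∧
      ∀ j, j ≠ i → prodForm u v (ψ j) = 0 := by
  obtain ⟨P, hpos, hzero⟩ := h
  have hw : P.weight (some i) (ψ i) ≠ 0 := fun hw => by
    have := hpos i
    simp [LOCC.prob, hw] at this
  obtain ⟨u, v, huv, hz⟩ := P.exists_prodForm (some i) (ψ i) hw
  refine ⟨u, v, huv, fun j hj => hz _ ?_⟩
  -- Since `x / 0 = 0`, a zero probability could also come from `ψ j = 0`; this is excluded by the
  -- positive probability of the correct answer on `ψ j`.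
  rcases div_eq_zero_iff.1 (hzero j i hj) with h0 | h0
  · exact h0
  · have := hpos j
    simp [LOCC.prob, h0] at this

/-! ### Sufficiency: a random choice followed by local tests -/

section Protocol

variable {α β : Type} [Fintype α] [Fintype β]

/-- The orthogonal projection onto the line spanned by the conjugate of `u`. -/
def lineProj (u : α → ℂ) : Matrix α α ℂ :=
  (u ⬝ᵥ star u)⁻¹ • Matrix.vecMulVec (star u) u

lemma dotProduct_star_self_ne_zero {u : α → ℂ} (hu : u ≠ 0) : u ⬝ᵥ star u ≠ 0 := by
  open ComplexOrder in
  rwa [Ne, dotProduct_comm, dotProduct_star_self_eq_zero]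

lemma lineProj_conjTranspose (u : α → ℂ) : (lineProj u).conjTranspose = lineProj u := by
  have h : star (u ⬝ᵥ star u) = u ⬝ᵥ star u := by
    rw [← Matrix.star_dotProduct_star, star_star]
  ext x y
  simp only [lineProj, Matrix.conjTranspose_apply, Matrix.smul_apply, Matrix.vecMulVec_apply,
    smul_eq_mul, star_mul', star_inv₀, h, Pi.star_apply, star_star]
  ring

lemma lineProj_mul_self {u : α → ℂ} (hu : u ≠ 0) : lineProj u * lineProj u = lineProj u := by
  have h := dotProduct_star_self_ne_zero hu
  rw [lineProj, Matrix.smul_mul, Matrix.mul_smul, Matrix.vecMulVec_mul_vecMulVec, smul_smul,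
    Matrix.vecMulVec_smul, smul_smul]
  congr 1
  field_simp

/-- The Kraus operators of the two-outcome measurement that tests for the conjugate of `u`;
the system is relabelled by `Fin (card α)`. -/
def testKraus [DecidableEq α] (u : α → ℂ) (i : Fin 2) : Matrix (Fin (Fintype.card α)) α ℂ :=
  (if i = 0 then lineProj u else 1 - lineProj u).submatrix (Fintype.equivFin α).symm id

lemma testKraus_complete [DecidableEq α] {u : α → ℂ} (hu : u ≠ 0) :
    ∑ i, (testKraus u i).conjTranspose * testKraus u i = 1 := by
  simp only [testKraus, Matrix.conjTranspose_submatrix, Matrix.submatrix_mul_equiv,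
    Fin.sum_univ_two, if_true, if_neg (one_ne_zero (α := Fin 2))]
  rw [Matrix.conjTranspose_sub, Matrix.conjTranspose_one, lineProj_conjTranspose,
    lineProj_mul_self hu, sub_mul, mul_sub, mul_sub, lineProj_mul_self hu]
  simp

/-- The Kraus operators of a fair coin with `n` sides. -/
def coinKraus [DecidableEq α] (n : ℕ) (_ : Fin n) : Matrix (Fin (Fintype.card α)) α ℂ :=
  ((Real.sqrt n : ℂ)⁻¹ • (1 : Matrix α α ℂ)).submatrix (Fintype.equivFin α).symm id

lemma coinKraus_complete [DecidableEq α] {n : ℕ} (hn : n ≠ 0) :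
    ∑ i, (coinKraus (α := α) n i).conjTranspose * coinKraus (α := α) n i = 1 := by
  have h : ((Real.sqrt n : ℂ)) * (Real.sqrt n : ℂ) = n := by
    rw [← Complex.ofReal_mul, Real.mul_self_sqrt (Nat.cast_nonneg n), Complex.ofReal_natCast]
  have hn' : (n : ℂ) ≠ 0 := Nat.cast_ne_zero.2 hn
  simp only [coinKraus, Matrix.conjTranspose_submatrix, Matrix.submatrix_mul_equiv,
    Matrix.conjTranspose_smul, Matrix.conjTranspose_one, Matrix.mul_smul,
    smul_smul, mul_one, Finset.sum_const, Finset.card_univ, Fintype.card_fin]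
  rw [star_inv₀, show star (Real.sqrt n : ℂ) = (Real.sqrt n : ℂ) from Complex.conj_ofReal _,
    ← mul_inv, h, Matrix.submatrix_id_id, ← Nat.cast_smul_eq_nsmul ℂ, smul_smul,
    mul_inv_cancel₀ hn', one_smul]

omit [Fintype β] in
lemma actA_testKraus_zero_apply [DecidableEq α] (u : α → ℂ) (ψ : BiVec α β)
    (p : Fin (Fintype.card α) × β) :
    ψ.actA (testKraus u 0) p = (u ⬝ᵥ star u)⁻¹ * star (u ((Fintype.equivFin α).symm p.1)) *
      ∑ x, u x * ψ (x, p.2) := by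
  simp only [actA, testKraus, lineProj, if_true, Matrix.submatrix_apply, Matrix.smul_apply,
    Matrix.vecMulVec_apply, Pi.star_apply, id, smul_eq_mul, Finset.mul_sum]
  exact Finset.sum_congr rfl fun _ _ => by ring

omit [Fintype α] in
lemma actB_testKraus_zero_apply [DecidableEq β] (v : β → ℂ) (ψ : BiVec α β)
    (p : α × Fin (Fintype.card β)) :
    ψ.actB (testKraus v 0) p = (v ⬝ᵥ star v)⁻¹ * star (v ((Fintype.equivFin β).symm p.2)) *
      ∑ y, v y * ψ (p.1, y) := by
  simp only [actB, testKraus, lineProj, if_true, Matrix.submatrix_apply, Matrix.smul_apply,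
    Matrix.vecMulVec_apply, Pi.star_apply, id, smul_eq_mul, Finset.mul_sum]
  exact Finset.sum_congr rfl fun _ _ => by ring

/-- When both tests succeed, the state collapses onto the fixed nonzero vector `star u ⊗ star v`,
with amplitude proportional to `prodForm u v ψ`. -/
lemma actB_actA_testKraus_eq_zero [DecidableEq α] [DecidableEq β] {u : α → ℂ} {v : β → ℂ}
    (hu : u ≠ 0) (hv : v ≠ 0) (ψ : BiVec α β) :
    (ψ.actA (testKraus u 0)).actB (testKraus v 0) = 0 ↔ prodForm u v ψ = 0 := by
  have key : ∀ p, (ψ.actA (testKraus u 0)).actB (testKraus v 0) p =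
      (u ⬝ᵥ star u)⁻¹ * (v ⬝ᵥ star v)⁻¹ * star (u ((Fintype.equivFin α).symm p.1)) *
        star (v ((Fintype.equivFin β).symm p.2)) * prodForm u v ψ := fun p => by
    rw [actB_testKraus_zero_apply]
    simp only [actA_testKraus_zero_apply, prodForm, Finset.mul_sum]
    rw [Finset.sum_comm]
    exact Finset.sum_congr rfl fun _ _ => Finset.sum_congr rfl fun _ _ => by ring
  constructor
  · intro h
    obtain ⟨x, hx⟩ := Function.ne_iff.1 hu
    obtain ⟨y, hy⟩ := Function.ne_iff.1 hv
    have := key (Fintype.equivFin α x, Fintype.equivFin β y)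
    rw [h] at this
    simpa [dotProduct_star_self_ne_zero hu, dotProduct_star_self_ne_zero hv,
      show u x ≠ 0 from hx, show v y ≠ 0 from hy] using this
  · intro h
    funext p
    rw [key, h, mul_zero]
    rfl

/-- The protocol that announces `r` if both parties' tests succeed, and `none` otherwise. -/
def testProtocol {ι : Type} [DecidableEq α] [DecidableEq β] {u : α → ℂ} {v : β → ℂ}
    (hu : u ≠ 0) (hv : v ≠ 0) (r : ι) : LOCC (Option ι) α β :=
  .alice 2 _ (testKraus u) (testKraus_complete hu) fun i =>
    if i = 0 then .bob 2 _ (testKraus v) (testKraus_complete hv) fun j =>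
      .done (if j = 0 then some r else none)
    else .done none

lemma weight_testProtocol {ι : Type} [DecidableEq ι] [DecidableEq α] [DecidableEq β] {u : α → ℂ}
    {v : β → ℂ} (hu : u ≠ 0) (hv : v ≠ 0) (r s : ι) (ψ : BiVec α β) :
    (testProtocol hu hv r).weight (some s) ψ =
      if r = s then ((ψ.actA (testKraus u 0)).actB (testKraus v 0)).normSq else 0 := by
  simp [testProtocol, LOCC.weight, Fin.sum_univ_two]

/-- Alice's coin selects which index to test. The answer `i` arises only in branch `i`, where it has
zero weight exactly on the kernel of the `i`-th functional. -/
theorem conclusivelyDistinguishable_of_prodForm {n : ℕ} {ψ : Fin n → BiVec α β}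
    (h : ∀ i, ∃ (u : α → ℂ) (v : β → ℂ), prodForm u v (ψ i) ≠ 0 ∧
      ∀ j, j ≠ i → prodForm u v (ψ j) = 0) :
    ConclusivelyDistinguishable ψ := by
  classical
  rcases Nat.eq_zero_or_pos n with rfl | hn
  -- A coin without sides need not satisfy the completeness relation, so the empty family is treated
  -- apart.
  · exact ⟨.done none, fun i => i.elim0, fun i => i.elim0⟩
  choose u v huv hz using h
  set e := Fintype.equivFin α
  set c : ℂ := (Real.sqrt n : ℂ)⁻¹ with hc
  have hc0 : c ≠ 0 := by
    rw [hc, Ne, inv_eq_zero, Complex.ofReal_eq_zero]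
    exact (Real.sqrt_pos.2 (Nat.cast_pos.2 hn)).ne'
  have hform : ∀ (i k : Fin n) (χ : BiVec α β),
      prodForm (u i ∘ e.symm) (v i) (χ.actA (coinKraus n k)) = c * prodForm (u i) (v i) χ := by
    intro i k χ
    rw [prodForm_actA]
    have : Matrix.vecMul (u i ∘ e.symm) (coinKraus n k) = c • u i := by
      funext x
      simp only [Matrix.vecMul, dotProduct, coinKraus, Matrix.submatrix_apply, Function.comp,
        Matrix.smul_apply, id, Pi.smul_apply]
      rw [e.symm.sum_comp (fun z => u i z * (c • (1 : Matrix α α ℂ) z x))]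
      simp [Matrix.one_apply, mul_comm]
    rw [this]
    simp [prodForm, Finset.mul_sum, mul_assoc]
  have hu : ∀ i, u i ∘ e.symm ≠ 0 := fun i h0 => huv i <| by
    have : u i = 0 := funext fun x => by simpa using congrFun h0 (e x)
    simp [prodForm, this]
  have hv : ∀ i, v i ≠ 0 := fun i h0 => huv i <| by simp [prodForm, h0]
  let P : LOCC (Option (Fin n)) α β := .alice n _ (coinKraus n) (coinKraus_complete hn.ne')
    fun i => testProtocol (hu i) (hv i) i
  have hP : ∀ (i : Fin n) (χ : BiVec α β), P.weight (some i) χ = 0 ↔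
      prodForm (u i) (v i) χ = 0 := by
    intro i χ
    simp only [P, LOCC.weight, weight_testProtocol, Finset.sum_ite_eq', Finset.mem_univ, if_true]
    rw [normSq_eq_zero, actB_actA_testKraus_eq_zero (hu i) (hv i), hform]
    simp [hc0]
  refine ⟨P, fun i => ?_, fun i j hij => ?_⟩
  · refine div_pos ((LOCC.weight_nonneg _ _ _).lt_of_ne' fun h0 => huv i ((hP i _).1 h0))
      ((normSq_nonneg _).lt_of_ne' fun h0 => huv i ?_)
    rw [normSq_eq_zero.1 h0, prodForm_zero]
  · rw [LOCC.prob, (hP j _).2 (hz j i hij), zero_div]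

end Protocol

/-! ### Functionals of rank two from an entangled resource -/

section Resource

variable {α β α' β' : Type} [Fintype α] [Fintype β] [Fintype α'] [Fintype β']

/-- If all 2 × 2 minors vanish, the column and the normalized row through a nonzero entry factor
`Φ`. -/
lemma BiVec.IsEntangled.exists_minor_ne_zero {Φ : BiVec α' β'} (h : Φ.IsEntangled) :
    ∃ s s' t t', Φ (s, t) * Φ (s', t') - Φ (s, t') * Φ (s', t) ≠ 0 := by
  by_contra! hc
  refine h ?_
  by_cases h0 : ∃ s t, Φ (s, t) ≠ 0
  · obtain ⟨s, t, hst⟩ := h0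
    refine ⟨fun x => Φ (x, t), fun y => Φ (s, y) / Φ (s, t), fun x y => ?_⟩
    have := hc s x t y
    field_simp
    linear_combination this
  · push Not at h0
    exact ⟨0, 0, fun x y => by simp [h0]⟩

/-- An entangled vector has Schmidt rank at least two. -/
lemma BiVec.IsEntangled.exists_dual_pair {Φ : BiVec α' β'} (h : Φ.IsEntangled) :
    ∃ (a₁ a₂ : α' → ℂ) (b₁ b₂ : β' → ℂ), prodForm a₁ b₁ Φ = 1 ∧ prodForm a₂ b₂ Φ = 1 ∧
      prodForm a₁ b₂ Φ = 0 ∧ prodForm a₂ b₁ Φ = 0 := by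
  classical
  obtain ⟨s, s', t, t', hΔ⟩ := h.exists_minor_ne_zero
  set Δ := Φ (s, t) * Φ (s', t') - Φ (s, t') * Φ (s', t) with hΔ'
  have key : ∀ z (p q : ℂ), prodForm (Pi.single z 1) (Pi.single t p + Pi.single t' q) Φ =
      p * Φ (z, t) + q * Φ (z, t') := fun z p q => by
    simp [prodForm, Pi.single_apply, ite_mul, add_mul, Finset.sum_add_distrib]
  -- `b₁` and `b₂` are the columns of the inverse of the 2 × 2 submatrix of `Φ` with determinant
  -- `Δ`.
  refine ⟨Pi.single s 1, Pi.single s' 1,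
    Pi.single t (Φ (s', t') / Δ) + Pi.single t' (-Φ (s', t) / Δ),
    Pi.single t (-Φ (s, t') / Δ) + Pi.single t' (Φ (s, t) / Δ), ?_, ?_, ?_, ?_⟩ <;> rw [key]
  · field_simp
    rw [hΔ']
    ring
  · field_simp
    rw [hΔ']
    ring
  · ring
  · ring

/-- For a dual pair on `Φ` the cross terms vanish, and a product functional on the joint system
restricts to a sum of two product functionals on `ψ`. -/
lemma prodForm_withResource (p₁ p₂ : α → ℂ) (q₁ q₂ : β → ℂ) (a₁ a₂ : α' → ℂ) (b₁ b₂ : β' → ℂ)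
    (ψ : BiVec α β) (Φ : BiVec α' β') :
    prodForm (fun x : α × α' => p₁ x.1 * a₁ x.2 + p₂ x.1 * a₂ x.2)
      (fun y : β × β' => q₁ y.1 * b₁ y.2 + q₂ y.1 * b₂ y.2) (ψ.withResource Φ) =
    prodForm p₁ q₁ ψ * prodForm a₁ b₁ Φ + prodForm p₁ q₂ ψ * prodForm a₁ b₂ Φ +
      prodForm p₂ q₁ ψ * prodForm a₂ b₁ Φ + prodForm p₂ q₂ ψ * prodForm a₂ b₂ Φ := by
  have key : ∀ (p : α → ℂ) (q : β → ℂ) (a : α' → ℂ) (b : β' → ℂ),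
      prodForm p q ψ * prodForm a b Φ = ∑ x : α × α', ∑ y : β × β',
        p x.1 * a x.2 * (q y.1 * b y.2) * ψ.withResource Φ (x, y) := by
    intro p q a b
    simp only [prodForm, withResource, Fintype.sum_prod_type, Finset.sum_mul_sum]
    refine Finset.sum_congr rfl fun _ _ => Finset.sum_congr rfl fun _ _ =>
      Finset.sum_congr rfl fun _ _ => Finset.sum_congr rfl fun _ _ => ?_
    ring
  simp only [key, ← Finset.sum_add_distrib]
  rw [prodForm]
  exact Finset.sum_congr rfl fun _ _ => Finset.sum_congr rfl fun _ _ => by ring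

/-- With an entangled resource, functionals of rank two can be implemented conclusively. -/
theorem conclusivelyDistinguishable_withResource {n : ℕ} {ψ : Fin n → BiVec α β}
    (h : ∀ i, ∃ (p₁ p₂ : α → ℂ) (q₁ q₂ : β → ℂ), prodForm p₁ q₁ (ψ i) + prodForm p₂ q₂ (ψ i) ≠ 0 ∧
      ∀ j, j ≠ i → prodForm p₁ q₁ (ψ j) + prodForm p₂ q₂ (ψ j) = 0)
    {Φ : BiVec α' β'} (hΦ : Φ.IsEntangled) :
    ConclusivelyDistinguishable fun i => (ψ i).withResource Φ := by
  obtain ⟨a₁, a₂, b₁, b₂, h11, h22, h12, h21⟩ := hΦ.exists_dual_pair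
  refine conclusivelyDistinguishable_of_prodForm fun i => ?_
  obtain ⟨p₁, p₂, q₁, q₂, hi, hj⟩ := h i
  refine ⟨fun x => p₁ x.1 * a₁ x.2 + p₂ x.1 * a₂ x.2,
    fun y => q₁ y.1 * b₁ y.2 + q₂ y.1 * b₂ y.2, ?_, fun j hji => ?_⟩
  · simpa [prodForm_withResource, h11, h22, h12, h21] using hi
  · simpa [prodForm_withResource, h11, h22, h12, h21] using hj j hji

end Resource

/-! ### Families of diagonal vectors together with vectors `|0 y⟩` -/

section DiagonalFamily

variable {d d' n : ℕ}

/-- The vector `∑ j, c j |j j⟩`. -/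
def diagVec (c : Fin d → ℂ) : BiVec (Fin d) (Fin d') :=
  fun p => if (p.1 : ℕ) = p.2 then c p.1 else 0

lemma prodForm_diagVec (hd : d ≤ d') (u : Fin d → ℂ) (v : Fin d' → ℂ) (c : Fin d → ℂ) :
    prodForm u v (diagVec c) = ∑ j, c j * (u j * v (Fin.castLE hd j)) := by
  refine Finset.sum_congr rfl fun x _ => ?_
  rw [Finset.sum_eq_single (Fin.castLE hd x)]
  · simp [diagVec, mul_comm]
  · intro y _ hy
    have : ¬ (x : ℕ) = y := fun h => hy (Fin.ext h.symm)
    simp [diagVec, this]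
  · simp

lemma prodForm_ket (u : Fin d → ℂ) (v : Fin d' → ℂ) (x : Fin d) (y : Fin d') :
    prodForm u v (ket x y) = u x * v y := by
  rw [prodForm, Finset.sum_eq_single x, Finset.sum_eq_single y]
  · simp [ket]
  · intro z _ hz
    simp [ket, Fin.val_inj, hz]
  · simp
  · intro z _ hz
    simp [ket, Fin.val_inj, hz]
  · simp

/-- The family consists of the diagonal vectors whose coefficients are the rows of an invertible
matrix `D` with pairwise orthogonal rows, and of some vectors `|0 y⟩` with `y ≠ 0`, among them
`|0 1⟩`. The map `κ` tells which member of the family is which of these vectors. -/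
structure IsDiagonalFamily (ψ : Fin n → BiVec (Fin d) (Fin d')) (D : Matrix (Fin d) (Fin d) ℂ)
    (N : Fin d → ℂ) (κ : Fin n → Fin d ⊕ Fin d') : Prop where
  two_le : 2 ≤ d
  le : d ≤ d'
  mul_conjTranspose : D * D.conjTranspose = Matrix.diagonal N
  ne_zero : ∀ k, N k ≠ 0
  injective : Function.Injective κ
  inl_mem : ∃ i k, κ i = Sum.inl k ∧ ∀ j, D k j ≠ 0
  inl_surj : ∀ k, ∃ i, κ i = Sum.inl k
  inr_mem : ∃ i y, κ i = Sum.inr y ∧ (y : ℕ) = 1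
  inr_ne : ∀ i y, κ i = Sum.inr y → (y : ℕ) ≠ 0
  eq : ∀ i, ψ i = Sum.elim (fun k => diagVec (D k)) (fun y : Fin d' => ket 0 y) (κ i)

namespace IsDiagonalFamily

variable {ψ : Fin n → BiVec (Fin d) (Fin d')} {D : Matrix (Fin d) (Fin d) ℂ} {N : Fin d → ℂ}
  {κ : Fin n → Fin d ⊕ Fin d'}

/-- The inverse of `D` is `Dᴴ * diagonal N⁻¹`, whose `k`-th column is a multiple of the conjugated
`k`-th row of `D`. -/
lemma eq_smul_of_mulVec (h : IsDiagonalFamily ψ D N κ) {w : Fin d → ℂ} {k : Fin d}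
    (hw : ∀ l, l ≠ k → (D.mulVec w) l = 0) (j : Fin d) :
    w j = (D.mulVec w) k / N k * star (D k j) := by
  have h1 : D * (D.conjTranspose * Matrix.diagonal fun l => (N l)⁻¹) = 1 := by
    rw [← mul_assoc, h.mul_conjTranspose, Matrix.diagonal_mul_diagonal, ← Matrix.diagonal_one]
    congr 1
    exact funext fun l => mul_inv_cancel₀ (h.ne_zero l)
  have h2 : w = (D.conjTranspose * Matrix.diagonal fun l => (N l)⁻¹).mulVec (D.mulVec w) := by
    rw [Matrix.mulVec_mulVec, mul_eq_one_comm.1 h1, Matrix.one_mulVec]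
  have h3 := congrFun h2 j
  rw [Matrix.mulVec, dotProduct, Finset.sum_eq_single k] at h3
  · rw [h3, Matrix.mul_diagonal, Matrix.conjTranspose_apply]
    ring
  · intro l _ hl
    rw [hw l hl, mul_zero]
  · simp

theorem not_conclusivelyDistinguishable (h : IsDiagonalFamily ψ D N κ) :
    ¬ ConclusivelyDistinguishable ψ := by
  intro hc
  obtain ⟨i, k, hik, hk⟩ := h.inl_mem
  obtain ⟨u, v, hne, hz⟩ := hc.exists_prodForm i
  set w : Fin d → ℂ := fun j => u j * v (Fin.castLE h.le j) with hw
  have hform : ∀ i' l, κ i' = Sum.inl l → prodForm u v (ψ i') = D.mulVec w l := by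
    intro i' l hl
    rw [h.eq, hl, Sum.elim_inl, prodForm_diagVec h.le]
    rfl
  -- Vanishing on the other diagonal states makes `w` a nonzero multiple of the conjugate of row
  -- `k`, which has no zero entry.
  have hw0 : ∀ j, w j ≠ 0 := by
    intro j
    rw [h.eq_smul_of_mulVec (w := w) (k := k) (fun l hl => ?_)]
    · rw [hform i k hik] at hne
      exact mul_ne_zero (div_ne_zero hne (h.ne_zero k)) (star_ne_zero.2 (hk j))
    · obtain ⟨i', hi'⟩ := h.inl_surj l
      rw [← hform i' l hi']
      refine hz _ fun hii => hl ?_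
      rw [hii, hik] at hi'
      exact (Sum.inl.inj hi').symm
  obtain ⟨i', y, hiy, hy⟩ := h.inr_mem
  have h01 : prodForm u v (ψ i') = 0 := hz _ fun hii => by
    rw [hii, hik] at hiy
    cases hiy
  have hd := h.two_le
  rw [h.eq, hiy, Sum.elim_inr, show (0 : ℕ) = ((⟨0, by omega⟩ : Fin d) : ℕ) from rfl,
    prodForm_ket] at h01
  have hy' : y = Fin.castLE h.le ⟨1, by omega⟩ := Fin.ext hy
  rw [hy'] at h01
  rcases mul_eq_zero.1 h01 with h0 | h0
  · exact hw0 ⟨0, by omega⟩ (by simp [hw, h0])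
  · exact hw0 ⟨1, by omega⟩ (by simp only [hw, h0, mul_zero])

theorem conclusivelyDistinguishable_withResource (h : IsDiagonalFamily ψ D N κ) {α' β' : Type}
    [Fintype α'] [Fintype β'] {Φ : BiVec α' β'} (hΦ : Φ.IsEntangled) :
    ConclusivelyDistinguishable fun i => (ψ i).withResource Φ := by
  have hd := h.two_le
  have hd' := h.le
  let x₀ : Fin d := ⟨0, by omega⟩
  let y₀ : Fin d' := ⟨0, by omega⟩
  have hx₀ : Fin.castLE h.le x₀ = y₀ := rfl
  have hne : ∀ j, j ≠ x₀ → Fin.castLE h.le j ≠ y₀ := fun j hj hc => hj (Fin.castLE_injective _ hc)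
  refine _root_.conclusivelyDistinguishable_withResource (fun i => ?_) hΦ
  rcases hi : κ i with k | y
  -- The two terms separate index `0` from the others. On `|j j⟩` their sum is `star (D k j)`, the
  -- dual of row `k`; on `|0 y⟩` with `y ≠ 0` it vanishes. Its values on other off-diagonal vectors
  -- are irrelevant.
  · refine ⟨fun x => if x = x₀ then star (D k x) else 0, fun x => if x = x₀ then 0 else star (D k x),
      fun y => if y = y₀ then 1 else 0, fun y => if y = y₀ then 0 else 1, ?_⟩
    have hdiag : ∀ l, prodForm (fun x => if x = x₀ then star (D k x) else 0)
        (fun y : Fin d' => if y = y₀ then 1 else 0) (diagVec (D l)) +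
        prodForm (fun x => if x = x₀ then 0 else star (D k x))
        (fun y : Fin d' => if y = y₀ then 0 else 1) (diagVec (D l)) =
        Matrix.diagonal N l k := by
      intro l
      rw [prodForm_diagVec h.le, prodForm_diagVec h.le, ← Finset.sum_add_distrib,
        ← h.mul_conjTranspose, Matrix.mul_apply]
      refine Finset.sum_congr rfl fun j _ => ?_
      by_cases hj : j = x₀
      · subst hj
        simp [hx₀]
      · simp [hj, hne j hj]
    constructor
    · rw [h.eq, hi, Sum.elim_inl, hdiag, Matrix.diagonal_apply_eq]
      exact h.ne_zero k
    · intro j hj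
      rw [h.eq]
      rcases hκ : κ j with l | y
      · rw [Sum.elim_inl, hdiag, Matrix.diagonal_apply_ne]
        rintro rfl
        exact hj (h.injective (hκ.trans hi.symm))
      · have hy : y ≠ y₀ := fun hc => h.inr_ne j y hκ (congrArg Fin.val hc)
        rw [Sum.elim_inr, show (0 : ℕ) = (x₀ : ℕ) from rfl, prodForm_ket, prodForm_ket]
        simp [hy]
  · have hy : y ≠ y₀ := fun hc => h.inr_ne i y hi (congrArg Fin.val hc)
    -- For `|0 y⟩` its own coordinate functional, of rank one, suffices.
    refine ⟨Pi.single x₀ 1, 0, Pi.single y 1, 0, ?_⟩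
    have h0 : ∀ χ : BiVec (Fin d) (Fin d'), prodForm 0 0 χ = 0 := fun χ => by simp [prodForm]
    simp only [h0, add_zero, prodForm_single]
    constructor
    · simp [h.eq, hi, ket, x₀]
    · intro j hj
      rw [h.eq]
      rcases hκ : κ j with l | z
      · have : ¬ (0 : ℕ) = y := fun hc => h.inr_ne i y hi hc.symm
        simp [diagVec, x₀, this]
      · have : ¬ (y : ℕ) = z := fun hc => hj (h.injective (by rw [hi, hκ, Fin.ext hc]))
        simp [ket, this]

end IsDiagonalFamily

end DiagonalFamily

/-! ### The constructed sets are diagonal families -/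

section ConstructedSets

variable {d d' n : ℕ}

lemma diagVec_eq_sum (c : Fin d → ℂ) :
    (diagVec c : BiVec (Fin d) (Fin d')) = ∑ j : Fin d, c j • ket j j := by
  funext p
  rw [Finset.sum_apply, Finset.sum_eq_single p.1]
  · simp [diagVec, ket, eq_comm]
  · intro j _ hj
    have : ¬ (p.1 : ℕ) = j := fun h => hj (Fin.ext h.symm)
    simp [ket, this]
  · simp

lemma IsDiagonalFamily.snoc {ψ : Fin n → BiVec (Fin d) (Fin d')} {D : Matrix (Fin d) (Fin d) ℂ}
    {N : Fin d → ℂ} {κ : Fin n → Fin d ⊕ Fin d'} (h : IsDiagonalFamily ψ D N κ) (y : Fin d')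
    (hy : (y : ℕ) ≠ 0) (hκ : ∀ i, κ i ≠ Sum.inr y) :
    IsDiagonalFamily (Fin.snoc (α := fun _ => BiVec (Fin d) (Fin d')) ψ (ket 0 y)) D N
      (Fin.snoc (α := fun _ => Fin d ⊕ Fin d') κ (Sum.inr y)) where
  two_le := h.two_le
  le := h.le
  mul_conjTranspose := h.mul_conjTranspose
  ne_zero := h.ne_zero
  injective := Fin.snoc_injective_of_injective h.injective fun ⟨i, hi⟩ => hκ i hi
  inl_mem := by
    obtain ⟨i, k, hik, hk⟩ := h.inl_mem
    exact ⟨i.castSucc, k, by rw [Fin.snoc_castSucc, hik], hk⟩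
  inl_surj k := by
    obtain ⟨i, hi⟩ := h.inl_surj k
    exact ⟨i.castSucc, by rw [Fin.snoc_castSucc, hi]⟩
  inr_mem := by
    obtain ⟨i, z, hiz, hz⟩ := h.inr_mem
    exact ⟨i.castSucc, z, by rw [Fin.snoc_castSucc, hiz], hz⟩
  inr_ne i z := by
    refine Fin.lastCases ?_ (fun i => ?_) i
    · rw [Fin.snoc_last]
      rintro ⟨⟩
      exact hy
    · rw [Fin.snoc_castSucc]
      exact h.inr_ne i z
  eq i := by
    refine Fin.lastCases ?_ (fun i => ?_) i
    · simp only [Fin.snoc_last, Sum.elim_inr]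
    · simp only [Fin.snoc_castSucc]
      exact h.eq i

/-- The diagonal vectors given by the rows of `D`, followed by `|0 1⟩`. -/
lemma isDiagonalFamily_snoc (hd : 2 ≤ d) (hd' : d ≤ d') {D : Matrix (Fin d) (Fin d) ℂ}
    {N : Fin d → ℂ} (hD : D * D.conjTranspose = Matrix.diagonal N) (hN : ∀ k, N k ≠ 0)
    (h0 : ∃ k, ∀ j, D k j ≠ 0) :
    IsDiagonalFamily
      (Fin.snoc (α := fun _ => BiVec (Fin d) (Fin d')) (fun k => diagVec (D k)) (ket 0 1)) D N
      (Fin.snoc (α := fun _ => Fin d ⊕ Fin d') Sum.inl (Sum.inr ⟨1, by omega⟩)) where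
  two_le := hd
  le := hd'
  mul_conjTranspose := hD
  ne_zero := hN
  injective := Fin.snoc_injective_of_injective Sum.inl_injective fun ⟨i, hi⟩ => by cases hi
  inl_mem := by
    obtain ⟨k, hk⟩ := h0
    exact ⟨k.castSucc, k, by rw [Fin.snoc_castSucc], hk⟩
  inl_surj k := ⟨k.castSucc, by rw [Fin.snoc_castSucc]⟩
  inr_mem := ⟨Fin.last d, ⟨1, by omega⟩, by rw [Fin.snoc_last], rfl⟩
  inr_ne i z := by
    refine Fin.lastCases ?_ (fun i => ?_) i
    · rw [Fin.snoc_last]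
      rintro ⟨⟩
      exact one_ne_zero
    · rw [Fin.snoc_castSucc]
      rintro ⟨⟩
  eq i := by
    refine Fin.lastCases ?_ (fun i => ?_) i
    · simp only [Fin.snoc_last, Sum.elim_inr]
    · simp only [Fin.snoc_castSucc, Sum.elim_inl]

/-- The unnormalized matrix of the discrete Fourier transform. -/
def fourierMatrix (d : ℕ) : Matrix (Fin d) (Fin d) ℂ :=
  fun k j => Complex.exp (2 * Real.pi * Complex.I / d) ^ ((k : ℕ) * (j : ℕ))

/-- Orthogonality of characters: each entry is a geometric sum whose ratio is a `d`-th root of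
unity, equal to `1` only on the diagonal. -/
lemma fourierMatrix_mul_conjTranspose (hd : d ≠ 0) :
    fourierMatrix d * (fourierMatrix d).conjTranspose = Matrix.diagonal fun _ => (d : ℂ) := by
  set ζ := Complex.exp (2 * Real.pi * Complex.I / d) with hζdef
  have hζ : IsPrimitiveRoot ζ d := Complex.isPrimitiveRoot_exp d hd
  have hζ0 : ζ ≠ 0 := Complex.exp_ne_zero _
  have hstar : star ζ = ζ⁻¹ := by
    rw [Complex.inv_def, Complex.normSq_eq_norm_sq, hζ.norm'_eq_one hd]
    simp
  ext k l
  have hsum : (fourierMatrix d * (fourierMatrix d).conjTranspose) k l =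
      ∑ j ∈ Finset.range d, (ζ ^ (k : ℕ) * (ζ ^ (l : ℕ))⁻¹) ^ j := by
    rw [Matrix.mul_apply, ← Fin.sum_univ_eq_sum_range]
    refine Finset.sum_congr rfl fun j _ => ?_
    rw [Matrix.conjTranspose_apply, fourierMatrix, fourierMatrix, ← hζdef, star_pow, hstar,
      mul_pow, inv_pow, pow_mul, pow_mul, inv_pow]
  rw [hsum]
  by_cases hkl : k = l
  · subst hkl
    rw [mul_inv_cancel₀ (pow_ne_zero _ hζ0), Matrix.diagonal_apply_eq]
    simp
  · rw [Matrix.diagonal_apply_ne _ hkl]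
    have hne : ζ ^ (k : ℕ) * (ζ ^ (l : ℕ))⁻¹ - 1 ≠ 0 := fun hc => hkl <| Fin.ext <|
      hζ.pow_inj k.2 l.2 <| by
        rw [← div_eq_mul_inv, sub_eq_zero, div_eq_one_iff_eq (pow_ne_zero _ hζ0)] at hc
        exact hc
    refine (mul_eq_zero.1 ?_).resolve_right hne
    rw [geom_sum_mul, mul_pow, inv_pow, ← pow_mul, ← pow_mul, mul_comm (k : ℕ), mul_comm (l : ℕ),
      pow_mul, pow_mul, hζ.pow_eq_one]
    simp

lemma isDiagonalFamily_nuSet (hd : 2 ≤ d) (hd' : d ≤ d') :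
    IsDiagonalFamily (nuSet d d') (fourierMatrix d) (fun _ => (d : ℂ))
      (Fin.snoc (α := fun _ => Fin d ⊕ Fin d') Sum.inl (Sum.inr ⟨1, by omega⟩)) := by
  have h := isDiagonalFamily_snoc hd hd' (fourierMatrix_mul_conjTranspose (d := d) (by omega))
    (fun _ => Nat.cast_ne_zero.2 (by omega))
    ⟨⟨0, by omega⟩, fun j => pow_ne_zero _ (Complex.exp_ne_zero _)⟩
  simp only [diagVec_eq_sum] at h
  exact h

lemma isDiagonalFamily_nuSetExtended (hd' : 3 ≤ d') :
    ∃ D N κ, IsDiagonalFamily (nuSetExtended d') D N κ := by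
  refine ⟨_, _, _, (isDiagonalFamily_nuSet (by norm_num) hd').snoc ⟨2, by omega⟩ two_ne_zero
    fun i => ?_⟩
  refine Fin.lastCases ?_ (fun i => ?_) i
  · rw [Fin.snoc_last]
    simp
  · rw [Fin.snoc_castSucc]
    simp

lemma map_ofReal_mul_conjTranspose {D : Matrix (Fin d) (Fin d) ℝ} {N : ℝ}
    (h : D * D.transpose = Matrix.diagonal fun _ => N) :
    D.map Complex.ofReal * (D.map Complex.ofReal).conjTranspose =
      Matrix.diagonal fun _ => (N : ℂ) := by
  ext k l
  have := congrArg Complex.ofReal (congrFun (congrFun h k) l)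
  simp only [Matrix.mul_apply, Matrix.transpose_apply, Complex.ofReal_sum,
    Complex.ofReal_mul] at this
  simp only [Matrix.mul_apply, Matrix.conjTranspose_apply, Matrix.map_apply, Complex.star_def,
    Complex.conj_ofReal]
  rw [this]
  by_cases hkl : k = l <;> simp [hkl]

lemma isDiagonalFamily_muSet (hd' : 4 ≤ d') :
    ∃ D N κ, IsDiagonalFamily (muSet d') D N κ := by
  let D : Matrix (Fin 4) (Fin 4) ℝ := !![1, 1, 1, 1; 1, 1, -1, -1; 1, -1, -1, 1; 1, -1, 1, -1]
  have hD : D * D.transpose = Matrix.diagonal fun _ => 4 := by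
    ext k l
    fin_cases k <;> fin_cases l <;> simp [D, Matrix.mul_apply, Fin.sum_univ_four] <;> norm_num
  have h := isDiagonalFamily_snoc (by norm_num) hd' (map_ofReal_mul_conjTranspose hD)
    (fun _ => by norm_num) ⟨0, fun j => by fin_cases j <;> simp [D]⟩
  suffices hs : muSet d' = Fin.snoc (α := fun _ => BiVec (Fin 4) (Fin d'))
      (fun k => diagVec (D.map Complex.ofReal k)) (ket 0 1) from ⟨_, _, _, hs ▸ h⟩
  funext i
  refine Fin.lastCases ?_ (fun k => ?_) i
  · rw [Fin.snoc_last]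
    rfl
  · rw [Fin.snoc_castSucc]
    fin_cases k <;>
      simp [muSet, diagVec_eq_sum, Fin.sum_univ_four, D, sub_eq_add_neg]

/-- Rows from different pairs are orthogonal because `(a, b) ⊥ (b, -a)` and `(c, d) ⊥ (d, -c)`;
within a pair, because `(e, f) ⊥ (f, -e)` and `(g, h) ⊥ (h, -g)`. The first row has no zero entry.
-/
lemma isDiagonalFamily_alphaSet (hd' : 4 ≤ d') {a b c d e f g h : ℝ} (ha : a ≠ 0) (hb : b ≠ 0)
    (hc : c ≠ 0) (hd : d ≠ 0) (he : e ≠ 0) (hf : f ≠ 0) (hab : a ^ 2 + b ^ 2 = 1)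
    (hcd : c ^ 2 + d ^ 2 = 1) (hef : e ^ 2 + f ^ 2 = 1) (hgh : g ^ 2 + h ^ 2 = 1) :
    ∃ D N κ, IsDiagonalFamily (alphaSet d' a b c d e f g h) D N κ := by
  let D : Matrix (Fin 4) (Fin 4) ℝ := !![e * a, e * b, f * c, f * d; f * a, f * b, -e * c, -e * d;
    g * b, -g * a, h * d, -h * c; h * b, -h * a, -g * d, g * c]
  have hD : D * D.transpose = Matrix.diagonal fun _ => 1 := by
    ext k l
    fin_cases k <;> fin_cases l <;> simp [D, Matrix.mul_apply, Fin.sum_univ_four]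
    · linear_combination e ^ 2 * hab + f ^ 2 * hcd + hef
    · linear_combination e * f * (hab - hcd)
    · ring
    · ring
    · linear_combination e * f * (hab - hcd)
    · linear_combination f ^ 2 * hab + e ^ 2 * hcd + hef
    · ring
    · ring
    · ring
    · ring
    · linear_combination g ^ 2 * hab + h ^ 2 * hcd + hgh
    · linear_combination g * h * (hab - hcd)
    · ring
    · ring
    · linear_combination g * h * (hab - hcd)
    · linear_combination h ^ 2 * hab + g ^ 2 * hcd + hgh
  have hfam := isDiagonalFamily_snoc (by norm_num) hd' (map_ofReal_mul_conjTranspose hD)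
    (fun _ => by norm_num) ⟨0, fun j => by fin_cases j <;> simp [D, ha, hb, hc, hd, he, hf]⟩
  suffices hs : alphaSet d' a b c d e f g h = Fin.snoc (α := fun _ => BiVec (Fin 4) (Fin d'))
      (fun k => diagVec (D.map Complex.ofReal k)) (ket 0 1) from ⟨_, _, _, hs ▸ hfam⟩
  funext i
  refine Fin.lastCases ?_ (fun k => ?_) i
  · rw [Fin.snoc_last]
    rfl
  · rw [Fin.snoc_castSucc]
    fin_cases k <;>
      simp [alphaSet, diagVec_eq_sum, Fin.sum_univ_four, D] <;> module

lemma IsConstructedSet.isDiagonalFamily {ψ : Fin n → BiVec (Fin d) (Fin d')}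
    (h : IsConstructedSet ψ) : ∃ D N κ, IsDiagonalFamily ψ D N κ := by
  cases h with
  | nu _ _ hd hd' => exact ⟨_, _, _, isDiagonalFamily_nuSet hd hd'⟩
  | nuExtended _ hd' => exact isDiagonalFamily_nuSetExtended hd'
  | mu _ hd' => exact isDiagonalFamily_muSet hd'
  | alpha _ hd' a b c d e f g h ha hb hc hd he hf hg hh hab hcd hef hgh =>
    exact isDiagonalFamily_alphaSet hd' ha.1.ne' hb.1.ne' hc.1.ne' hd.1.ne' he.1.ne' hf.1.ne'
      hab hcd hef hgh

end ConstructedSets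

end

theorem theorem2 {d d' n : ℕ} (ψ : Fin n → BiVec (Fin d) (Fin d')) (hψ : IsConstructedSet ψ) :
    ¬ ConclusivelyDistinguishable ψ ∧
    ∀ (m m' : ℕ) (Φ : BiVec (Fin m) (Fin m')), Φ.IsEntangled →
      ConclusivelyDistinguishable (fun i => (ψ i).withResource Φ) := by
  obtain ⟨D, N, κ, h⟩ := hψ.isDiagonalFamily
  exact ⟨h.not_conclusivelyDistinguishable,
    fun m m' Φ hΦ => h.conclusivelyDistinguishable_withResource hΦ⟩
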